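/- Let $G=(V,E)$ be a finite connected simple graph, $\partial V\subset V$, and $0\ne g:\partial V\to\mathbb R$ with $\sum_{i\in\partial V}g_i=0$; put $\mathrm{int}(V)=V\setminus\partial V$. Let $\mathcal H(E)$ be the space of real $V\times V$ matrices vanishing off the edges, $(Du)_{ij}=u_i-u_j$ if $ij\in E$ and $0$ otherwise, $(\operatorname{div}b)_i=\sum_j(b_{ji}-b_{ij})$, $\langle b,c\rangle=\sum_{i,j}b_{ij}c_{ij}$. Let $a\in\mathcal H(E)$ be symmetric with $a_{ij}\ge 0$, fix $v_g\in\mathbb R^V$ with $\sum_{i\in\partial V}(v_g)_ig_i=1$, and let $\mathcal M_0=\{u\in\mathbb R^V:\sum_{i\in\partial V}u_ig_i=0\}$. Consider $$(P_N)\quad \alpha_{P_N}=\min_{u\in\mathcal M_0}\tfrac12\langle a,|Du+Dv_g|\rangle,\qquad (D_N)\quad \alpha_{D_N}=\sup_{b\in\mathcal D}-\langle b,Dv_g\rangle,$$ where $\mathcal D$ is the set of $b\in\mathcal H(E)$ with $|b_{ij}|\le\frac12a_{ij}$ for all $i,j$ such that, for some $\mu\in\mathbb R$, $\operatorname{div}b=\mu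 g$ on $\partial V$ and $\operatorname{div}b=0$ on $\mathrm{int}(V)$. For $h:\partial V\to\mathbb R$, a function $w\in\mathbb R^V$ is a voltage potential for $(h,a)$ with induced current $J$ if $J\in\mathcal H(E)$ is antisymmetric, $\sum_jJ_{ij}=h_i$ on $\partial V$ and $=0$ on $\mathrm{int}(V)$, and there is a symmetric $\sigma$ with entries in $[0,\infty]$, zero off the edges, such that $\sigma_{ij}<\infty$, $J_{ij}=\sigma_{ij}(w_i-w_j)$ and $|J_{ij}|=a_{ij}$ whenever $w_i\ne w_j$, and $\sigma_{ij}=\infty$ whenever $w_i=w_j$ and $a_{ij}\neq0$. Algorithm 2. Let $\alpha>0$, $b^0,d^0\in\mathcal H(E)$, fix a vertex $o$, and let $z\in\mathbb R^V$ satisfy $z_o=0$, $\sum_j(Dz)_{ij}=g_i$ on $\partial V$ and $=0$ on $\mathrm{int}(V)$. For $k\ge0$: (1) let $u^{k+1}$ solve $\sum_j(Du^{k+1})_{ij}=\frac12[(\operatorname{div}b^k)_i-(\operatorname{div}d^k)_i]$ for all $i\in V$, $u^{k+1}_o=0$; put $\beta^{k+1}=-\sum_{i\in\partial V}u_i^{k+1}g_i\big/\sum_{i\in\partial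 V}z_ig_i$ and $v^{k+1}=u^{k+1}+\beta^{k+1}z$; (2) with $w_{ij}=(Dv^{k+1})_{ij}+(Dv_g)_{ij}+b^k_{ij}$ put $d^{k+1}_{ij}=\max\{|w_{ij}|-\frac{a_{ij}}{2\alpha},0\}\frac{w_{ij}}{|w_{ij}|}-(Dv_g)_{ij}$ (the first term being $0$ if $w_{ij}=0$); (3) put $b^{k+1}=b^k+Dv^{k+1}-d^{k+1}$. Then such sequences exist, and for all such sequences there are $v\in\mathbb R^V$, $J\in\mathcal H(E)$ and $\lambda\in\mathbb R$ such that $v^k\to v$, $b^k\to\frac1{2\alpha}J$ and $d^k\to Dv$; $v$ is a solution of $(P_N)$ and $-\frac12J$ is a solution of $(D_N)$; both optimal values are attained and $\lambda=\alpha_{P_N}=\alpha_{D_N}$. Moreover $v+v_g$ is a voltage potential for $(\lambda g,a)$, $|J_{ij}|=a_{ij}$ for all $i,j$ with $(v+v_g)_i\neq(v+v_g)_j$, and the antisymmetric part $\frac12(J-J^{T})$ is an induced current of $v+v_g$ for $(\lambda g,a)$; if $b^0$ is antisymmetric, then $J$ itself is an induced current of $v+v_g$ for $(\lambda g,a)$.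 -/

import Mathlib

open Filter Topology
open scoped ENNReal

noncomputable section

namespace Network

variable {V : Type*} [Fintype V]

/-- The space `H(E)`: real matrices that vanish off the edges of `G` (in particular on the
diagonal, since a simple graph has no loops). -/
def edgeSpace (G : SimpleGraph V) : Set (V → V → ℝ) :=
  {b | ∀ i j, ¬ G.Adj i j → b i j = 0}

/-- The gradient `D u`. -/
def grad (G : SimpleGraph V) [DecidableRel G.Adj] (u : V → ℝ) : V → V → ℝ :=
  fun i j => if G.Adj i j then u i - u j else 0

/-- The divergence `(div b)_i = ∑_j (b_{ji} - b_{ij})`. -/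
def div (b : V → V → ℝ) : V → ℝ :=
  fun i => ∑ j, (b j i - b i j)

/-- The inner product of `H(E)`. -/
def edgeInner (b c : V → V → ℝ) : ℝ := ∑ i, ∑ j, b i j * c i j

/-- Measurement matrices: the nonnegative symmetric elements of `H(E)`. -/
structure IsMeasurement (G : SimpleGraph V) (a : V → V → ℝ) : Prop where
  mem_edgeSpace : a ∈ edgeSpace G
  nonneg : ∀ i j, 0 ≤ a i j
  symm : ∀ i j, a i j = a j i

/-- `σ` is a conductivity matrix for the injected current `g` on the boundary `B` and the
measurement matrix `a`, with voltage potential `v` and induced current `J`. A value `σ i j = ∞`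
describes a perfect conductor. -/
structure IsInducedBy (G : SimpleGraph V) (B : Finset V) (g : B → ℝ) (a : V → V → ℝ)
    (σ : V → V → ℝ≥0∞) (v : V → ℝ) (J : V → V → ℝ) : Prop where
  conductivity_symm : ∀ i j, σ i j = σ j i
  conductivity_off_edges : ∀ i j, ¬ G.Adj i j → σ i j = 0
  current_mem : J ∈ edgeSpace G
  current_antisymm : ∀ i j, J i j = - J j i
  ohm : ∀ i j, v i ≠ v j → σ i j ≠ ∞ ∧ J i j = (σ i j).toReal * (v i - v j)
  magnitude : ∀ i j, v i ≠ v j → |J i j| = a i j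
  perfect_conductor : ∀ i j, a i j ≠ 0 → v i = v j → σ i j = ∞
  kirchhoff_boundary : ∀ i : B, ∑ j, J i j = g i
  kirchhoff_interior : ∀ i, i ∉ B → ∑ j, J i j = 0

/-- The set of voltage potentials for the Neumann data `(g, a)`. -/
def voltagePotentials (G : SimpleGraph V) (B : Finset V) (g : B → ℝ) (a : V → V → ℝ) :
    Set (V → ℝ) :=
  {v | ∃ σ J, IsInducedBy G B g a σ v J}

/-- The space `M_0` of all `u` with `∑_{i ∈ B} u_i g_i = 0`. -/
def primalSpace (B : Finset V) (g : B → ℝ) : Set (V → ℝ) :=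
  {u | ∑ i : B, u i * g i = 0}

/-- The objective `u ↦ (1/2) ⟨a, |D u + D v_g|⟩` of the primal problem. -/
def primalObj (G : SimpleGraph V) [DecidableRel G.Adj] (a : V → V → ℝ) (vg u : V → ℝ) : ℝ :=
  1 / 2 * edgeInner a (fun i j => |grad G u i j + grad G vg i j|)

/-- `v` solves the primal problem, i.e. minimizes its objective over `M_0`. -/
def IsPrimalSolution (G : SimpleGraph V) [DecidableRel G.Adj] (B : Finset V) (g : B → ℝ)
    (a : V → V → ℝ) (vg v : V → ℝ) : Prop :=
  v ∈ primalSpace B g ∧ IsMinOn (primalObj G a vg) (primalSpace B g) v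

/-- The feasible set of the dual problem: all `b ∈ H(E)` with `|b| ≤ a / 2` whose divergence
vanishes off `B` and is a multiple of `g` on `B`. -/
def dualFeasible (G : SimpleGraph V) (B : Finset V) (g : B → ℝ) (a : V → V → ℝ) :
    Set (V → V → ℝ) :=
  {b | b ∈ edgeSpace G ∧
    (∃ μ : ℝ, (∀ i, i ∉ B → div b i = 0) ∧ ∀ i : B, div b i = μ * g i) ∧
    ∀ i j, |b i j| ≤ 1 / 2 * a i j}

/-- The objective `b ↦ -⟨b, D v_g⟩` of the dual problem. -/
def dualObj (G : SimpleGraph V) [DecidableRel G.Adj] (vg : V → ℝ) (b : V → V → ℝ) : ℝ :=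
  - edgeInner b (grad G vg)

/-- `b` solves the dual problem. -/
def IsDualSolution (G : SimpleGraph V) [DecidableRel G.Adj] (B : Finset V) (g : B → ℝ)
    (a : V → V → ℝ) (vg : V → ℝ) (b : V → V → ℝ) : Prop :=
  b ∈ dualFeasible G B g a ∧ IsMaxOn (dualObj G vg) (dualFeasible G B g a) b

/-- Soft thresholding `max(|w| - t, 0) w / |w|`, with value `0` at `w = 0`. -/
def shrink (t w : ℝ) : ℝ :=
  if w = 0 then 0 else max (|w| - t) 0 * (w / |w|)

/-- A run of the alternating split Bregman algorithm for the Neumann problem, with parameter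
`α`, normalizing vertex `o`, shift `vg` and initial values `b0`, `d0`. The entries `u 0`, `β 0`
and `v 0` are not used by the algorithm. -/
structure IsRun (G : SimpleGraph V) [DecidableRel G.Adj] (B : Finset V) (g : B → ℝ)
    (a : V → V → ℝ) (α : ℝ) (o : V) (vg : V → ℝ) (b0 d0 : V → V → ℝ)
    (z : V → ℝ) (u : ℕ → V → ℝ) (β : ℕ → ℝ) (v : ℕ → V → ℝ) (d b : ℕ → V → V → ℝ) :
    Prop where
  z_interior : ∀ i, i ∉ B → ∑ j, grad G z i j = 0
  z_boundary : ∀ i : B, ∑ j, grad G z i j = g i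
  z_base : z o = 0
  b_init : b 0 = b0
  d_init : d 0 = d0
  u_step : ∀ k i, ∑ j, grad G (u (k + 1)) i j = 1 / 2 * (div (b k) i - div (d k) i)
  u_base : ∀ k, u (k + 1) o = 0
  β_step : ∀ k, β (k + 1) = - (∑ i : B, u (k + 1) i * g i) / ∑ i : B, z i * g i
  v_step : ∀ k, v (k + 1) = u (k + 1) + β (k + 1) • z
  d_step : ∀ k i j, d (k + 1) i j =
    shrink (a i j / (2 * α)) (grad G (v (k + 1)) i j + grad G vg i j + b k i j)
      - grad G vg i j
  b_step : ∀ k i j, b (k + 1) i j = b k i j + grad G (v (k + 1)) i j - d (k + 1) i j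

end Network

end

noncomputable section

namespace Network

variable {V : Type*}

open Classical in
/-- Extension by zero of a function on the boundary. -/
def zeroExtend (B : Finset V) (g : B → ℝ) : V → ℝ :=
  fun i => if h : i ∈ B then g ⟨i, h⟩ else 0

lemma zeroExtend_of_mem (B : Finset V) (g : B → ℝ) (i : B) : zeroExtend B g i = g i := by
  simp [zeroExtend]

lemma zeroExtend_of_notMem (B : Finset V) (g : B → ℝ) {i : V} (hi : i ∉ B) :
    zeroExtend B g i = 0 := by
  simp [zeroExtend, hi]

lemma sum_mul_zeroExtend [Fintype V] (B : Finset V) (g : B → ℝ) (u : V → ℝ) :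
    ∑ i, u i * zeroExtend B g i = ∑ i : B, u i * g i := by
  have h1 : ∑ i : B, u i * g i = ∑ i : B, u i * zeroExtend B g i :=
    Finset.sum_congr rfl fun i _ => by rw [zeroExtend_of_mem]
  rw [h1, Finset.sum_coe_sort B (fun i => u i * zeroExtend B g i)]
  refine (Finset.sum_subset (Finset.subset_univ B) fun i _ hi => ?_).symm
  rw [zeroExtend_of_notMem B g hi, mul_zero]

lemma sum_zeroExtend [Fintype V] (B : Finset V) (g : B → ℝ) : ∑ i, zeroExtend B g i = ∑ i : B, g i := by
  simpa using sum_mul_zeroExtend B g (fun _ => 1)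

lemma eq_zeroExtend_iff (B : Finset V) (g : B → ℝ) (f : V → ℝ) :
    f = zeroExtend B g ↔ (∀ i, i ∉ B → f i = 0) ∧ ∀ i : B, f i = g i := by
  constructor
  · rintro rfl
    exact ⟨fun i hi => zeroExtend_of_notMem B g hi, zeroExtend_of_mem B g⟩
  · rintro ⟨h1, h2⟩
    funext i
    by_cases hi : i ∈ B
    · rw [h2 ⟨i, hi⟩, zeroExtend_of_mem B g ⟨i, hi⟩]
    · rw [h1 i hi, zeroExtend_of_notMem B g hi]

lemma zeroExtend_smul (B : Finset V) (g : B → ℝ) (c : ℝ) :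
    zeroExtend B (c • g) = c • zeroExtend B g := by
  symm
  rw [eq_zeroExtend_iff]
  exact ⟨fun i hi => by simp [zeroExtend_of_notMem B g hi],
    fun i => by simp [zeroExtend_of_mem B g i]⟩

lemma zeroExtend_ne_zero (B : Finset V) {g : B → ℝ} (hg : g ≠ 0) : zeroExtend B g ≠ 0 := by
  intro h
  apply hg
  funext i
  rw [← zeroExtend_of_mem B g i, h]
  rfl

section Gradient

variable (G : SimpleGraph V) [DecidableRel G.Adj]

lemma grad_mem_edgeSpace (u : V → ℝ) : grad G u ∈ edgeSpace G := fun i j h => by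
  simp [grad, h]

lemma grad_add (u w : V → ℝ) : grad G (u + w) = grad G u + grad G w := by
  funext i j
  simp only [grad, Pi.add_apply]
  split_ifs <;> ring

lemma grad_smul (c : ℝ) (u : V → ℝ) : grad G (c • u) = c • grad G u := by
  funext i j
  simp only [grad, Pi.smul_apply, smul_eq_mul]
  split_ifs <;> ring

lemma grad_antisymm (u : V → ℝ) (i j : V) : grad G u i j = - grad G u j i := by
  simp only [grad, G.adj_comm i j]
  split_ifs <;> ring

/-- The gradient as a linear map. -/
def gradLin : (V → ℝ) →ₗ[ℝ] (V → V → ℝ) where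
  toFun := grad G
  map_add' := grad_add G
  map_smul' := grad_smul G

@[simp]
lemma gradLin_apply (u : V → ℝ) : gradLin G u = grad G u := rfl

variable {G}

lemma grad_sub (u w : V → ℝ) : grad G (u - w) = grad G u - grad G w := map_sub (gradLin G) u w

lemma eq_of_grad_eq_zero (hG : G.Connected) {u : V → ℝ} (h : grad G u = 0) (i j : V) :
    u i = u j := by
  obtain ⟨p⟩ := hG.preconnected i j
  induction p with
  | nil => rfl
  | cons hadj p ih =>
    rename_i x y z
    rw [← ih]
    have := congrFun (congrFun h x) y
    simp only [grad, hadj, if_true, Pi.zero_apply] at this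
    linarith

/-- Convergence of potentials normalized at a vertex follows from that of their gradients. -/
lemma tendsto_of_tendsto_grad (hG : G.Connected) {o : V} {w : ℕ → V → ℝ} {w' : V → ℝ}
    (ho : Tendsto (fun k => w k o) atTop (𝓝 (w' o)))
    (h : Tendsto (fun k => grad G (w k)) atTop (𝓝 (grad G w'))) : Tendsto w atTop (𝓝 w') := by
  refine tendsto_pi_nhds.2 fun i => ?_
  obtain ⟨p⟩ := hG.preconnected i o
  induction p with
  | nil => exact ho
  | cons hadj p ih =>
    rename_i x y _
    have h1 := tendsto_pi_nhds.1 (tendsto_pi_nhds.1 h x) y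
    simp only [grad, hadj, if_true] at h1
    simpa using h1.add (ih ho)

variable [Fintype V]

lemma edgeInner_grad (u : V → ℝ) {c : V → V → ℝ} (hc : c ∈ edgeSpace G) :
    edgeInner (grad G u) c = - ∑ i, u i * div c i := by
  have h : ∀ i j, grad G u i j * c i j = u i * c i j - u j * c i j := fun i j => by
    by_cases hij : G.Adj i j
    · simp only [grad, hij, if_true]; ring
    · rw [hc i j hij]; ring
  have h2 : ∑ i, ∑ j, u j * c i j = ∑ i, ∑ j, u i * c j i := Finset.sum_comm
  simp only [edgeInner, h, div, Finset.sum_sub_distrib, h2, Finset.mul_sum, mul_sub]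
  ring

lemma edgeInner_comm (b c : V → V → ℝ) : edgeInner b c = edgeInner c b := by
  simp only [edgeInner, mul_comm]

lemma sum_div (c : V → V → ℝ) : ∑ i, div c i = 0 := by
  simp only [div, Finset.sum_sub_distrib]
  rw [Finset.sum_comm, sub_self]

lemma div_add (b c : V → V → ℝ) : div (b + c) = div b + div c := by
  funext i
  simp only [div, Pi.add_apply, ← Finset.sum_add_distrib]
  exact Finset.sum_congr rfl fun j _ => by ring

lemma div_smul (r : ℝ) (c : V → V → ℝ) : div (r • c) = r • div c := by
  funext i
  simp only [div, Pi.smul_apply, smul_eq_mul, Finset.mul_sum]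
  exact Finset.sum_congr rfl fun j _ => by ring

lemma div_sub (b c : V → V → ℝ) : div (b - c) = div b - div c := by
  funext i
  simp only [div, Pi.sub_apply, ← Finset.sum_sub_distrib]
  exact Finset.sum_congr rfl fun j _ => by ring

/-- On antisymmetric matrices the divergence is `-2` times the row sum. -/
lemma div_of_antisymm {c : V → V → ℝ} (hc : ∀ i j, c i j = - c j i) (i : V) :
    div c i = -2 * ∑ j, c i j := by
  simp only [div, Finset.mul_sum]
  exact Finset.sum_congr rfl fun j _ => by rw [hc j i]; ring

lemma div_grad (u : V → ℝ) (i : V) : div (grad G u) i = -2 * ∑ j, grad G u i j :=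
  div_of_antisymm (grad_antisymm G u) i

lemma sum_grad_eq_zero (u : V → ℝ) : ∑ i, ∑ j, grad G u i j = 0 := by
  have h := sum_div (grad G u)
  simp only [div_grad, ← Finset.mul_sum] at h
  linarith

lemma edgeInner_grad_self (u : V → ℝ) :
    edgeInner (grad G u) (grad G u) = 2 * ∑ i, u i * ∑ j, grad G u i j := by
  rw [edgeInner_grad u (grad_mem_edgeSpace G u)]
  simp only [div_grad, Finset.mul_sum, ← Finset.sum_neg_distrib]
  exact Finset.sum_congr rfl fun i _ => Finset.sum_congr rfl fun j _ => by ring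

lemma edgeInner_self_nonneg (c : V → V → ℝ) : 0 ≤ edgeInner c c :=
  Finset.sum_nonneg fun _ _ => Finset.sum_nonneg fun _ _ => mul_self_nonneg _

lemma sq_le_edgeInner_self (c : V → V → ℝ) (i j : V) : c i j ^ 2 ≤ edgeInner c c := by
  have h1 : c i j * c i j ≤ ∑ j, c i j * c i j :=
    Finset.single_le_sum (f := fun j => c i j * c i j) (fun _ _ => mul_self_nonneg _)
      (Finset.mem_univ j)
  have h2 : ∑ j, c i j * c i j ≤ ∑ i, ∑ j, c i j * c i j :=
    Finset.single_le_sum (f := fun i => ∑ j, c i j * c i j)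
      (fun _ _ => Finset.sum_nonneg fun _ _ => mul_self_nonneg _) (Finset.mem_univ i)
  rw [sq]
  exact h1.trans h2

lemma eq_zero_of_edgeInner_self {c : V → V → ℝ} (h : edgeInner c c = 0) : c = 0 := by
  funext i j
  have := sq_le_edgeInner_self c i j
  rw [h] at this
  exact pow_eq_zero_iff two_ne_zero |>.1 (le_antisymm this (sq_nonneg _))

/-- Solvability of the discrete Poisson equation, normalized at `o`. -/
lemma exists_laplacian_eq (hG : G.Connected) (o : V) (f : V → ℝ) (hf : ∑ i, f i = 0) :
    ∃ u : V → ℝ, u o = 0 ∧ ∀ i, ∑ j, grad G u i j = f i := by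
  have hcard : (Fintype.card V : ℝ) ≠ 0 := by
    have : Nonempty V := ⟨o⟩
    exact_mod_cast Fintype.card_ne_zero
  let T : (V → ℝ) →ₗ[ℝ] (V → ℝ) :=
    { toFun := fun u i => ∑ j, grad G u i j + u o
      map_add' := fun u w => by
        funext i
        simp only [grad_add, Pi.add_apply, Finset.sum_add_distrib]; ring
      map_smul' := fun c u => by
        funext i
        simp only [grad_smul, Pi.smul_apply, smul_eq_mul, ← Finset.mul_sum, RingHom.id_apply]
        ring }
  have key : ∀ u : V → ℝ, ∑ i, T u i = 0 → u o = 0 := fun u h => by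
    have h' : ∑ i, (∑ j, grad G u i j + u o) = 0 := h
    rw [Finset.sum_add_distrib, sum_grad_eq_zero] at h'
    simpa [hcard] using h'
  have hinj : Function.Injective T := by
    rw [← LinearMap.ker_eq_bot, LinearMap.ker_eq_bot']
    intro u hu
    have ho : u o = 0 := key u (by simp [hu])
    have hL : ∀ i, ∑ j, grad G u i j = 0 := fun i => by
      have : ∑ j, grad G u i j + u o = 0 := congrFun hu i
      rwa [ho, add_zero] at this
    have hgr : grad G u = 0 := eq_zero_of_edgeInner_self (by
      rw [edgeInner_grad_self]; simp [hL])
    funext i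
    rw [eq_of_grad_eq_zero hG hgr i o, ho]; rfl
  obtain ⟨u, hu⟩ := LinearMap.surjective_of_injective hinj f
  have ho : u o = 0 := key u (by rw [hu, hf])
  refine ⟨u, ho, fun i => ?_⟩
  have : ∑ j, grad G u i j + u o = f i := congrFun hu i
  rwa [ho, add_zero] at this

/-- The algorithm can always be run. -/
lemma exists_isRun (hG : G.Connected) (B : Finset V) (g : B → ℝ) (hgsum : ∑ i : B, g i = 0)
    (a : V → V → ℝ) (α : ℝ) (o : V) (vg : V → ℝ) (b0 d0 : V → V → ℝ) :
    ∃ z u β v d b, IsRun G B g a α o vg b0 d0 z u β v d b := by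
  obtain ⟨z, hzo, hz⟩ := exists_laplacian_eq hG o (zeroExtend B g)
    (by rw [sum_zeroExtend, hgsum])
  have hsolve : ∀ s : (V → V → ℝ) × (V → V → ℝ), ∃ u : V → ℝ, u o = 0 ∧
      ∀ i, ∑ j, grad G u i j = 1 / 2 * (div s.1 i - div s.2 i) := fun s =>
    exists_laplacian_eq hG o _ (by
      rw [← Finset.mul_sum, Finset.sum_sub_distrib, sum_div, sum_div]; simp)
  choose U hUo hU using hsolve
  let β : (V → V → ℝ) × (V → V → ℝ) → ℝ := fun s =>
    - (∑ i : B, U s i * g i) / ∑ i : B, z i * g i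
  let W : (V → V → ℝ) × (V → V → ℝ) → V → ℝ := fun s => U s + β s • z
  let dn : (V → V → ℝ) × (V → V → ℝ) → V → V → ℝ := fun s i j =>
    shrink (a i j / (2 * α)) (grad G (W s) i j + grad G vg i j + s.1 i j) - grad G vg i j
  let st : ℕ → (V → V → ℝ) × (V → V → ℝ) := fun k =>
    Nat.rec (b0, d0) (fun _ s => (fun i j => s.1 i j + grad G (W s) i j - dn s i j, dn s)) k
  exact ⟨z, fun k => U (st (k - 1)), fun k => β (st (k - 1)), fun k => W (st (k - 1)),
    fun k => (st k).2, fun k => (st k).1,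
    { z_interior := fun i hi => by rw [hz, zeroExtend_of_notMem B g hi]
      z_boundary := fun i => by rw [hz, zeroExtend_of_mem]
      z_base := hzo
      b_init := rfl
      d_init := rfl
      u_step := fun k i => hU (st k) i
      u_base := fun k => hUo (st k)
      β_step := fun k => rfl
      v_step := fun k => rfl
      d_step := fun k i j => rfl
      b_step := fun k i j => rfl }⟩

end Gradient

variable [Fintype V]

/-- `y` is a subgradient of `t * |·|` at `x`. -/
def IsAbsSubgrad (t x y : ℝ) : Prop := |y| ≤ t ∧ y * x = t * |x|

lemma IsAbsSubgrad.monotone {t x y x' y' : ℝ} (h : IsAbsSubgrad t x y)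
    (h' : IsAbsSubgrad t x' y') : 0 ≤ (y - y') * (x - x') := by
  have key : ∀ {s r : ℝ}, |s| ≤ t → s * r ≤ t * |r| := fun {s r} hs =>
    (le_abs_self _).trans (by rw [abs_mul]; gcongr)
  have h1 := key (r := x') h.1
  have h2 := key (r := x) h'.1
  have h3 := h.2
  have h4 := h'.2
  nlinarith

lemma isAbsSubgrad_sub_shrink {t : ℝ} (ht : 0 ≤ t) (w : ℝ) :
    IsAbsSubgrad t (shrink t w) (w - shrink t w) := by
  unfold shrink IsAbsSubgrad
  rcases lt_trichotomy w 0 with hw | rfl | hw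
  · rw [if_neg hw.ne, abs_of_neg hw, div_neg, div_self hw.ne]
    rcases le_total (-w - t) 0 with h | h
    · rw [max_eq_right h]
      simp only [zero_mul, sub_zero, abs_zero, mul_zero, and_true, abs_of_neg hw]
      linarith
    · rw [max_eq_left h]
      have h1 : w - (-w - t) * -1 = -t := by ring
      rw [h1, abs_neg, abs_of_nonneg ht, abs_of_nonpos (by linarith : (-w - t) * -1 ≤ 0)]
      exact ⟨le_rfl, by ring⟩
  · simp [ht]
  · rw [if_neg hw.ne', abs_of_pos hw, div_self hw.ne']
    rcases le_total (w - t) 0 with h | h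
    · rw [max_eq_right h]
      simp only [zero_mul, sub_zero, abs_zero, mul_zero, and_true, abs_of_pos hw]
      linarith
    · rw [max_eq_left h]
      have h1 : w - (w - t) * 1 = t := by ring
      rw [h1, abs_of_nonneg ht, abs_of_nonneg (by linarith : 0 ≤ (w - t) * 1)]
      exact ⟨le_rfl, rfl⟩

lemma shrink_neg (t w : ℝ) : shrink t (-w) = - shrink t w := by
  unfold shrink
  by_cases hw : w = 0
  · simp [hw]
  · rw [if_neg (neg_ne_zero.2 hw), if_neg hw, abs_neg]; ring

lemma shrink_zero_left (w : ℝ) : shrink 0 w = w := by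
  unfold shrink
  split_ifs with h
  · exact h.symm
  · rw [sub_zero, max_eq_left (abs_nonneg w), mul_div_cancel₀ _ (abs_ne_zero.2 h)]

/-- The weighted `ℓ¹` seminorm of a matrix. -/
def weightedNorm (t c : V → V → ℝ) : ℝ := ∑ i, ∑ j, t i j * |c i j|

lemma weightedNorm_nonneg {t : V → V → ℝ} (ht : ∀ i j, 0 ≤ t i j) (c : V → V → ℝ) :
    0 ≤ weightedNorm t c :=
  Finset.sum_nonneg fun i _ => Finset.sum_nonneg fun j _ => mul_nonneg (ht i j) (abs_nonneg _)

lemma weightedNorm_smul (t : V → V → ℝ) {r : ℝ} (hr : 0 < r) (c : V → V → ℝ) :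
    weightedNorm t (r • c) = r * weightedNorm t c := by
  simp only [weightedNorm, Finset.mul_sum, Pi.smul_apply, smul_eq_mul, abs_mul, abs_of_pos hr]
  exact Finset.sum_congr rfl fun i _ => Finset.sum_congr rfl fun j _ => by ring

lemma weightedNorm_add_le {t : V → V → ℝ} (ht : ∀ i j, 0 ≤ t i j) (b c : V → V → ℝ) :
    weightedNorm t (b + c) ≤ weightedNorm t b + weightedNorm t c := by
  simp only [weightedNorm, ← Finset.sum_add_distrib]
  gcongr with i _ j _
  rw [← mul_add]
  exact mul_le_mul_of_nonneg_left (abs_add_le _ _) (ht i j)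

/-- Every linear functional on matrices is the pairing with some matrix. -/
lemma exists_eq_edgeInner (f : (V → V → ℝ) →ₗ[ℝ] ℝ) :
    ∃ b : V → V → ℝ, ∀ c, f c = edgeInner b c := by
  classical
  refine ⟨fun i j => f (Pi.single i (Pi.single j 1)), fun c => ?_⟩
  have hc : c = ∑ i, ∑ j, c i j • (Pi.single i (Pi.single j 1) : V → V → ℝ) := by
    funext x y
    simp only [Finset.sum_apply, Pi.smul_apply, smul_eq_mul]
    rw [Finset.sum_eq_single x, Finset.sum_eq_single y]
    · simp
    · intro j _ hj; simp [Pi.single_eq_of_ne' hj]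
    · simp
    · intro i _ hi; simp [Pi.single_eq_of_ne' hi]
    · simp
  conv_lhs => rw [hc]
  simp only [map_sum, map_smul, smul_eq_mul, edgeInner, mul_comm]

lemma abs_le_of_edgeInner_le {t b : V → V → ℝ} (h : ∀ c, edgeInner b c ≤ weightedNorm t c)
    (i j : V) : |b i j| ≤ t i j := by
  classical
  have key : ∀ r : ℝ, b i j * r ≤ t i j * |r| := fun r => by
    have hs := h (Pi.single i (Pi.single j r))
    have e1 : edgeInner b (Pi.single i (Pi.single j r)) = b i j * r := by
      unfold edgeInner
      rw [Finset.sum_eq_single i, Finset.sum_eq_single j]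
      · simp
      · intro y _ hy; simp [Pi.single_eq_of_ne hy]
      · simp
      · intro x _ hx; simp [Pi.single_eq_of_ne hx]
      · simp
    have e2 : weightedNorm t (Pi.single i (Pi.single j r)) = t i j * |r| := by
      unfold weightedNorm
      rw [Finset.sum_eq_single i, Finset.sum_eq_single j]
      · simp
      · intro y _ hy; simp [Pi.single_eq_of_ne hy]
      · simp
      · intro x _ hx; simp [Pi.single_eq_of_ne hx]
      · simp
    rwa [e1, e2] at hs
  have h1 := key 1
  have h2 := key (-1)
  simp only [abs_neg, abs_one, mul_one, mul_neg] at h1 h2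
  exact abs_le.2 ⟨by linarith, h1⟩

/-- A weighted total variation attains its minimum on each affine subspace `w + S`. -/
lemma exists_weightedNorm_grad_min (G : SimpleGraph V) [DecidableRel G.Adj] {t : V → V → ℝ}
    (ht : ∀ i j, 0 ≤ t i j) (w : V → ℝ) (S : Submodule ℝ (V → ℝ)) :
    ∃ u ∈ S, ∀ φ ∈ S, weightedNorm t (grad G (u + w)) ≤ weightedNorm t (grad G (φ + w)) := by
  let A : (V → ℝ) →ₗ[ℝ] (V → V → ℝ) :=
    { toFun := fun u i j => t i j * grad G u i j
      map_add' := fun u v => by funext i j; simp [grad_add, mul_add]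
      map_smul' := fun c u => by
        funext i j; simp only [grad_smul, Pi.smul_apply, smul_eq_mul, RingHom.id_apply]; ring }
  have hA : ∀ u, ∑ i, ∑ j, |A u i j| = weightedNorm t (grad G u) := fun u => by
    unfold weightedNorm
    refine Finset.sum_congr rfl fun i _ => Finset.sum_congr rfl fun j _ => ?_
    change |t i j * grad G u i j| = _
    rw [abs_mul, abs_of_nonneg (ht i j)]
  have hclosed : IsClosed {x : V → V → ℝ | x - A w ∈ S.map A} :=
    (S.map A).closed_of_finiteDimensional.preimage (by fun_prop)
  have hcont : Continuous fun x : V → V → ℝ => ∑ i, ∑ j, |x i j| := by fun_prop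
  have hnorm : ∀ x : V → V → ℝ, ‖x‖ ≤ ∑ i, ∑ j, |x i j| := fun x => by
    have h0 : ∀ i, 0 ≤ ∑ j, |x i j| := fun i => Finset.sum_nonneg fun j _ => abs_nonneg _
    refine (pi_norm_le_iff_of_nonneg (Finset.sum_nonneg fun i _ => h0 i)).2 fun i => ?_
    refine le_trans ?_ (Finset.single_le_sum (f := fun i => ∑ j, |x i j|)
      (fun i _ => h0 i) (Finset.mem_univ i))
    refine (pi_norm_le_iff_of_nonneg (h0 i)).2 fun j => ?_
    exact Finset.single_le_sum (f := fun j => |x i j|) (fun j _ => abs_nonneg _)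
      (Finset.mem_univ j)
  have htend : Tendsto (fun x : V → V → ℝ => ∑ i, ∑ j, |x i j|) (cocompact _) atTop :=
    tendsto_atTop_mono hnorm (tendsto_norm_cocompact_atTop)
  obtain ⟨x, hx, hmin⟩ := hcont.continuousOn.exists_isMinOn' hclosed (x₀ := A w)
    (by simpa using ⟨0, S.zero_mem, map_zero A⟩) ((htend.eventually_ge_atTop _).filter_mono inf_le_left)
  obtain ⟨u, hu, hux⟩ := hx
  refine ⟨u, hu, fun φ hφ => ?_⟩
  have hxe : x = A (u + w) := by rw [map_add, hux]; simp
  have := hmin (show A (φ + w) ∈ _ from ⟨φ, hφ, by simp⟩)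
  simpa only [hxe, Set.mem_ofPred_eq, hA] using this

/-- A saddle point of the problem of minimizing `∑ t_{ij} |D u + D v_g|` over `∑ u_i γ_i = 0`. -/
structure IsSaddle (G : SimpleGraph V) [DecidableRel G.Adj] (γ : V → ℝ) (t : V → V → ℝ)
    (vg v : V → ℝ) (b : V → V → ℝ) : Prop where
  primal : ∑ i, v i * γ i = 0
  orthogonal : ∀ φ : V → ℝ, ∑ i, φ i * γ i = 0 → edgeInner (grad G φ) b = 0
  subgrad : ∀ i j, IsAbsSubgrad (t i j) (grad G v i j + grad G vg i j) (b i j)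

lemma exists_isSaddle {G : SimpleGraph V} [DecidableRel G.Adj] (hG : G.Connected)
    {γ : V → ℝ} (hγ : ∑ i, γ i = 0) {t : V → V → ℝ} (ht : ∀ i j, 0 ≤ t i j)
    {vg : V → ℝ} (hvg : ∑ i, vg i * γ i = 1) :
    ∃ v b, IsSaddle G γ t vg v b := by
  let ℓ : (V → ℝ) →ₗ[ℝ] ℝ :=
    { toFun := fun u => ∑ i, u i * γ i
      map_add' := fun u v => by simp [add_mul, Finset.sum_add_distrib]
      map_smul' := fun c u => by simp [Finset.mul_sum, mul_assoc] }
  obtain ⟨v, hv, hmin⟩ := exists_weightedNorm_grad_min G ht vg (LinearMap.ker ℓ)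
  have hvg' : ℓ vg = 1 := hvg
  set N : ℝ := weightedNorm t (grad G (v + vg))
  have hdom : ∀ w, N * ℓ w ≤ weightedNorm t (grad G w) := fun w => by
    rcases le_or_gt (ℓ w) 0 with h | h
    · exact (mul_nonpos_of_nonneg_of_nonpos (weightedNorm_nonneg ht _) h).trans
        (weightedNorm_nonneg ht _)
    · have h1 := hmin ((ℓ w)⁻¹ • w - vg) (by
        rw [LinearMap.mem_ker, map_sub, map_smul, hvg', smul_eq_mul, inv_mul_cancel₀ h.ne',
          sub_self])
      rw [sub_add_cancel, grad_smul, weightedNorm_smul t (inv_pos.2 h)] at h1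
      calc N * ℓ w ≤ ((ℓ w)⁻¹ * weightedNorm t (grad G w)) * ℓ w := by gcongr
        _ = weightedNorm t (grad G w) := by field_simp
  have hker : LinearMap.ker (gradLin G) ≤ LinearMap.ker ℓ := fun w hw => by
    obtain ⟨o⟩ := hG.nonempty
    have hc := eq_of_grad_eq_zero hG (LinearMap.mem_ker.1 hw)
    change ∑ i, w i * γ i = 0
    rw [Finset.sum_congr rfl fun i _ => by rw [hc i o], ← Finset.mul_sum, hγ, mul_zero]
  let f : (V → V → ℝ) →ₗ.[ℝ] ℝ :=
    ⟨LinearMap.range (gradLin G),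
      (N • (LinearMap.ker (gradLin G)).liftQ ℓ hker) ∘ₗ
        (gradLin G).quotKerEquivRange.symm.toLinearMap⟩
  have hf : ∀ w, f ⟨grad G w, ⟨w, rfl⟩⟩ = N * ℓ w := fun w => by
    have h1 := (gradLin G).quotKerEquivRange_symm_apply_image w ⟨w, rfl⟩
    exact congrArg (fun y => N * (LinearMap.ker (gradLin G)).liftQ ℓ hker y) h1
  obtain ⟨F, hF, hFN⟩ := exists_extension_of_le_sublinear f (weightedNorm t)
    (fun c hc x => weightedNorm_smul t hc x) (weightedNorm_add_le ht) (by
      rintro ⟨_, w, rfl⟩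
      exact (hf w).le.trans (hdom w))
  obtain ⟨b, hb⟩ := exists_eq_edgeInner F
  have hbD : ∀ w, edgeInner b (grad G w) = N * ℓ w := fun w => by
    rw [← hb, ← hf w]; exact hF ⟨grad G w, ⟨w, rfl⟩⟩
  have hbt : ∀ i j, |b i j| ≤ t i j := abs_le_of_edgeInner_le fun c => by
    rw [← hb]; exact hFN c
  have hle : ∀ i j, b i j * grad G (v + vg) i j ≤ t i j * |grad G (v + vg) i j| := fun i j =>
    (le_abs_self _).trans (by rw [abs_mul]; gcongr; exact hbt i j)
  have hsum : ∑ i, ∑ j, b i j * grad G (v + vg) i j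
      = ∑ i, ∑ j, t i j * |grad G (v + vg) i j| := by
    have h1 : edgeInner b (grad G (v + vg)) = N := by
      rw [hbD, map_add, LinearMap.mem_ker.1 hv, hvg', zero_add, mul_one]
    exact h1
  refine ⟨v, b, hv, fun φ hφ => ?_, fun i j => ⟨hbt i j, ?_⟩⟩
  · rw [edgeInner_comm, hbD, show ℓ φ = 0 from hφ, mul_zero]
  · have h1 := (Finset.sum_eq_sum_iff_of_le
      fun i _ => Finset.sum_le_sum fun j _ => hle i j).1 hsum i (Finset.mem_univ i)
    have h2 := (Finset.sum_eq_sum_iff_of_le fun j _ => hle i j).1 h1 j (Finset.mem_univ j)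
    rwa [grad_add] at h2

/-- Splitting identity behind the decay of the energy of the iterates. -/
lemma edgeInner_energy (p q r q' : V → V → ℝ) :
    edgeInner r r + edgeInner q q =
      edgeInner (r + p - q') (r + p - q') + edgeInner q' q' + 2 * edgeInner (r + p - q') q'
        + edgeInner (p - q) (p - q) - 2 * edgeInner p (p - q + r) := by
  simp only [edgeInner, Finset.mul_sum, ← Finset.sum_add_distrib, ← Finset.sum_sub_distrib]
  refine Finset.sum_congr rfl fun i _ => Finset.sum_congr rfl fun j _ => ?_
  simp only [Pi.add_apply, Pi.sub_apply]
  ring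

section Convergence

variable {G : SimpleGraph V} [DecidableRel G.Adj] {B : Finset V} {g : B → ℝ} {a : V → V → ℝ}
  {α : ℝ} {o : V} {vg : V → ℝ} {b0 d0 : V → V → ℝ} {z : V → ℝ} {u : ℕ → V → ℝ} {β : ℕ → ℝ}
  {v : ℕ → V → ℝ} {d b : ℕ → V → V → ℝ}

namespace IsRun

lemma sum_grad_z (h : IsRun G B g a α o vg b0 d0 z u β v d b) (i : V) :
    ∑ j, grad G z i j = zeroExtend B g i :=
  congrFun ((eq_zeroExtend_iff B g fun i => ∑ j, grad G z i j).2
    ⟨h.z_interior, h.z_boundary⟩) i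

lemma mem_edgeSpace (h : IsRun G B g a α o vg b0 d0 z u β v d b) (ha : a ∈ edgeSpace G)
    (hb0 : b0 ∈ edgeSpace G) (hd0 : d0 ∈ edgeSpace G) (k : ℕ) :
    b k ∈ edgeSpace G ∧ d k ∈ edgeSpace G := by
  induction k with
  | zero => exact ⟨h.b_init ▸ hb0, h.d_init ▸ hd0⟩
  | succ k ih =>
    have hd : d (k + 1) ∈ edgeSpace G := fun i j hij => by
      rw [h.d_step, ha i j hij, zero_div, shrink_zero_left, grad_mem_edgeSpace G _ i j hij,
        ih.1 i j hij, grad_mem_edgeSpace G _ i j hij]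
      ring
    refine ⟨fun i j hij => ?_, hd⟩
    rw [h.b_step, hd i j hij, ih.1 i j hij, grad_mem_edgeSpace G _ i j hij]
    ring

lemma antisymm (h : IsRun G B g a α o vg b0 d0 z u β v d b) (ha : ∀ i j, a i j = a j i)
    (hb0 : ∀ i j, b0 i j = - b0 j i) (k : ℕ) (i j : V) : b k i j = - b k j i := by
  induction k generalizing i j with
  | zero => rw [h.b_init]; exact hb0 i j
  | succ k ih =>
    rw [h.b_step, h.b_step, h.d_step, h.d_step, ha i j, grad_antisymm G (v (k + 1)) i j,
      grad_antisymm G vg i j, ih i j]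
    rw [show -grad G (v (k + 1)) j i + -grad G vg j i + -b k j i
      = -(grad G (v (k + 1)) j i + grad G vg j i + b k j i) by ring, shrink_neg]
    ring

lemma sum_z_mul_ne_zero (h : IsRun G B g a α o vg b0 d0 z u β v d b) (hg : g ≠ 0) :
    ∑ i : B, z i * g i ≠ 0 := by
  intro h0
  rw [← sum_mul_zeroExtend] at h0
  have h1 : grad G z = 0 := eq_zero_of_edgeInner_self (by
    rw [edgeInner_grad_self]
    simp only [h.sum_grad_z, h0, mul_zero])
  refine zeroExtend_ne_zero B hg (funext fun i => ?_)
  rw [← h.sum_grad_z, h1]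
  simp

lemma v_base (h : IsRun G B g a α o vg b0 d0 z u β v d b) (k : ℕ) : v (k + 1) o = 0 := by
  simp [h.v_step, h.u_base, h.z_base]

lemma v_mem (h : IsRun G B g a α o vg b0 d0 z u β v d b) (hg : g ≠ 0) (k : ℕ) :
    ∑ i, v (k + 1) i * zeroExtend B g i = 0 := by
  have hz := h.sum_z_mul_ne_zero hg
  rw [sum_mul_zeroExtend, h.v_step]
  simp only [Pi.add_apply, Pi.smul_apply, smul_eq_mul, add_mul, Finset.sum_add_distrib,
    mul_assoc, ← Finset.mul_sum]
  rw [h.β_step, div_mul_cancel₀ _ hz]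
  ring

/-- First-order optimality of the potential update. -/
lemma edgeInner_grad_eq_zero (h : IsRun G B g a α o vg b0 d0 z u β v d b)
    (ha : a ∈ edgeSpace G) (hb0 : b0 ∈ edgeSpace G) (hd0 : d0 ∈ edgeSpace G) (k : ℕ)
    {φ : V → ℝ} (hφ : ∑ i, φ i * zeroExtend B g i = 0) :
    edgeInner (grad G φ) (grad G (v (k + 1)) - d k + b k) = 0 := by
  obtain ⟨hb, hd⟩ := h.mem_edgeSpace ha hb0 hd0 k
  have hmem : grad G (v (k + 1)) - d k + b k ∈ edgeSpace G := fun i j hij => by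
    simp [grad_mem_edgeSpace G _ i j hij, hb i j hij, hd i j hij]
  have hdiv : ∀ i, div (grad G (v (k + 1)) - d k + b k) i
      = -2 * β (k + 1) * zeroExtend B g i := fun i => by
    have h1 : ∑ j, grad G (v (k + 1)) i j
        = 1 / 2 * (div (b k) i - div (d k) i) + β (k + 1) * zeroExtend B g i := by
      rw [h.v_step, grad_add, grad_smul, ← h.u_step, ← h.sum_grad_z, Finset.mul_sum,
        ← Finset.sum_add_distrib]
      rfl
    rw [div_add, div_sub, Pi.add_apply, Pi.sub_apply, div_grad, h1]
    ring
  rw [edgeInner_grad φ hmem]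
  simp only [hdiv, mul_left_comm (φ _), ← Finset.mul_sum, hφ, mul_zero, neg_zero]

lemma isAbsSubgrad (h : IsRun G B g a α o vg b0 d0 z u β v d b) (ha : ∀ i j, 0 ≤ a i j)
    (hα : 0 < α) (k : ℕ) (i j : V) :
    IsAbsSubgrad (a i j / (2 * α)) (d (k + 1) i j + grad G vg i j) (b (k + 1) i j) := by
  have ht : 0 ≤ a i j / (2 * α) := div_nonneg (ha i j) (by positivity)
  have := isAbsSubgrad_sub_shrink ht (grad G (v (k + 1)) i j + grad G vg i j + b k i j)
  rw [h.b_step, h.d_step]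
  convert this using 1 <;> ring

end IsRun

/-- The squared distance of the pair `(b, d)` to `(b', d')`. -/
def energy (b' d' b d : V → V → ℝ) : ℝ :=
  edgeInner (b - b') (b - b') + edgeInner (d - d') (d - d')

lemma energy_nonneg (b' d' b d : V → V → ℝ) : 0 ≤ energy b' d' b d :=
  add_nonneg (edgeInner_self_nonneg _) (edgeInner_self_nonneg _)

/-- The energy with respect to a saddle point decreases along a run. -/
lemma IsRun.energy_succ_le (h : IsRun G B g a α o vg b0 d0 z u β v d b)
    (hg : g ≠ 0) (ha : IsMeasurement G a) (hα : 0 < α)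
    (hb0 : b0 ∈ edgeSpace G) (hd0 : d0 ∈ edgeSpace G) {v' : V → ℝ} {b' : V → V → ℝ}
    (hs : IsSaddle G (zeroExtend B g) (fun i j => a i j / (2 * α)) vg v' b') (k : ℕ) :
    energy b' (grad G v') (b (k + 1)) (d (k + 1))
      + edgeInner (grad G (v (k + 1)) - d k) (grad G (v (k + 1)) - d k)
      ≤ energy b' (grad G v') (b k) (d k) := by
  have hE := edgeInner_energy (grad G (v (k + 1)) - grad G v') (d k - grad G v') (b k - b')
    (d (k + 1) - grad G v')
  have e1 : b k - b' + (grad G (v (k + 1)) - grad G v') - (d (k + 1) - grad G v')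
      = b (k + 1) - b' := by
    funext i j
    simp only [Pi.add_apply, Pi.sub_apply, h.b_step]
    ring
  have e2 : grad G (v (k + 1)) - grad G v' - (d k - grad G v') = grad G (v (k + 1)) - d k := by
    abel
  have hφ : ∑ i, (v (k + 1) - v') i * zeroExtend B g i = 0 := by
    simp only [Pi.sub_apply, sub_mul, Finset.sum_sub_distrib, h.v_mem hg, hs.primal, sub_zero]
  have e3 : edgeInner (grad G (v (k + 1)) - grad G v')
      (grad G (v (k + 1)) - d k + (b k - b')) = 0 := by
    have h1 := h.edgeInner_grad_eq_zero ha.mem_edgeSpace hb0 hd0 k hφ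
    have h2 := hs.orthogonal _ hφ
    rw [grad_sub] at h1 h2
    have h3 : ∀ p q r : V → V → ℝ, edgeInner p (q - r) = edgeInner p q - edgeInner p r := by
      intro p q r
      simp only [edgeInner, Pi.sub_apply, mul_sub, Finset.sum_sub_distrib]
    rw [← add_sub_assoc, h3, h1, h2, sub_zero]
  have e4 : 0 ≤ edgeInner (b (k + 1) - b') (d (k + 1) - grad G v') :=
    Finset.sum_nonneg fun i _ => Finset.sum_nonneg fun j _ => by
      have := (h.isAbsSubgrad ha.nonneg hα k i j).monotone (hs.subgrad i j)
      simpa only [Pi.sub_apply, add_sub_add_right_eq_sub] using this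
  rw [e1, e2, e3] at hE
  unfold energy
  linarith

lemma tendsto_of_edgeInner {c : ℕ → V → V → ℝ}
    (h : Tendsto (fun k => edgeInner (c k) (c k)) atTop (𝓝 0)) : Tendsto c atTop (𝓝 0) := by
  refine tendsto_pi_nhds.2 fun i => tendsto_pi_nhds.2 fun j => ?_
  have h1 : Tendsto (fun k => (c k i j) ^ 2) atTop (𝓝 0) :=
    squeeze_zero (fun k => sq_nonneg _) (fun k => sq_le_edgeInner_self _ i j) h
  have h2 := h1.sqrt
  simp only [Real.sqrt_sq_eq_abs, Real.sqrt_zero] at h2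
  exact (tendsto_zero_iff_abs_tendsto_zero _).2 h2

lemma continuous_edgeInner :
    Continuous fun p : (V → V → ℝ) × (V → V → ℝ) => edgeInner p.1 p.2 := by
  unfold edgeInner
  fun_prop

lemma isClosed_isAbsSubgrad (t : ℝ) : IsClosed {p : ℝ × ℝ | IsAbsSubgrad t p.1 p.2} := by
  have h1 : IsClosed {p : ℝ × ℝ | |p.2| ≤ t} := isClosed_le (by fun_prop) (by fun_prop)
  have h2 : IsClosed {p : ℝ × ℝ | p.2 * p.1 = t * |p.1|} :=
    isClosed_eq (by fun_prop) (by fun_prop)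
  exact h1.inter h2

/-- The iterates converge to a saddle point. -/
theorem IsRun.exists_tendsto_isSaddle (h : IsRun G B g a α o vg b0 d0 z u β v d b)
    (hG : G.Connected) (hg : g ≠ 0) (hgsum : ∑ i : B, g i = 0) (ha : IsMeasurement G a)
    (hα : 0 < α) (hvg : ∑ i : B, vg i * g i = 1)
    (hb0 : b0 ∈ edgeSpace G) (hd0 : d0 ∈ edgeSpace G) :
    ∃ v' b', IsSaddle G (zeroExtend B g) (fun i j => a i j / (2 * α)) vg v' b' ∧
      Tendsto v atTop (𝓝 v') ∧ Tendsto b atTop (𝓝 b') ∧ Tendsto d atTop (𝓝 (grad G v')) := by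
  obtain ⟨v₁, b₁, hs₁⟩ := exists_isSaddle (G := G) hG (γ := zeroExtend B g)
    (by rw [sum_zeroExtend, hgsum]) (t := fun i j => a i j / (2 * α))
    (fun i j => div_nonneg (ha.nonneg i j) (by positivity)) (vg := vg)
    (by rw [sum_mul_zeroExtend, hvg])
  have hanti : ∀ {v' b'}, IsSaddle G (zeroExtend B g) (fun i j => a i j / (2 * α)) vg v' b' →
      Antitone fun k => energy b' (grad G v') (b k) (d k) := fun hs =>
    antitone_nat_of_succ_le fun k =>
      (le_add_of_nonneg_right (edgeInner_self_nonneg _)).trans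
        (h.energy_succ_le hg ha hα hb0 hd0 hs k)
  have hres : Tendsto (fun k => grad G (v (k + 1)) - d k) atTop (𝓝 0) := by
    have hlim := tendsto_atTop_ciInf (hanti hs₁) ⟨0, by
      rintro _ ⟨k, rfl⟩; exact energy_nonneg _ _ _ _⟩
    have hdiff := hlim.sub (hlim.comp (tendsto_add_atTop_nat 1))
    rw [sub_self] at hdiff
    refine tendsto_of_edgeInner (squeeze_zero (fun k => edgeInner_self_nonneg _) (fun k => ?_)
      hdiff)
    have := h.energy_succ_le hg ha hα hb0 hd0 hs₁ k
    simp only [Function.comp]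
    linarith
  have hbdd : ∀ k, (b k - b₁, d k - grad G v₁) ∈ Metric.closedBall
      (0 : (V → V → ℝ) × (V → V → ℝ)) (√(energy b₁ (grad G v₁) (b 0) (d 0))) := fun k => by
    have hk := hanti hs₁ (Nat.zero_le k)
    have hn : ∀ c : V → V → ℝ, edgeInner c c ≤ energy b₁ (grad G v₁) (b 0) (d 0) →
        ‖c‖ ≤ √(energy b₁ (grad G v₁) (b 0) (d 0)) := fun c hc =>
      (pi_norm_le_iff_of_nonneg (Real.sqrt_nonneg _)).2 fun i =>
        (pi_norm_le_iff_of_nonneg (Real.sqrt_nonneg _)).2 fun j =>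
          Real.abs_le_sqrt ((sq_le_edgeInner_self c i j).trans hc)
    rw [mem_closedBall_zero_iff, Prod.norm_def]
    exact max_le
      (hn _ ((le_add_of_nonneg_right (edgeInner_self_nonneg _)).trans hk))
      (hn _ ((le_add_of_nonneg_left (edgeInner_self_nonneg _)).trans hk))
  obtain ⟨⟨b₂, d₂⟩, -, ψ, hψ, hlim⟩ := tendsto_subseq_of_bounded Metric.isBounded_closedBall hbdd
  have hbψ : Tendsto (fun k => b (ψ k)) atTop (𝓝 (b₂ + b₁)) := by
    simpa using ((continuous_fst.tendsto _).comp hlim).add_const b₁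
  have hdψ : Tendsto (fun k => d (ψ k)) atTop (𝓝 (d₂ + grad G v₁)) := by
    simpa using ((continuous_snd.tendsto _).comp hlim).add_const (grad G v₁)
  generalize b₂ + b₁ = b' at hbψ
  generalize d₂ + grad G v₁ = d' at hdψ
  have hvψ : Tendsto (fun k => grad G (v (ψ k + 1))) atTop (𝓝 d') := by
    simpa using (hres.comp hψ.tendsto_atTop).add hdψ
  let S : Submodule ℝ (V → ℝ) :=
    { carrier := {w | w o = 0 ∧ ∑ i, w i * zeroExtend B g i = 0}
      add_mem' := fun {x y} hx hy => ⟨by simp [hx.1, hy.1], by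
        simp [add_mul, Finset.sum_add_distrib, hx.2, hy.2]⟩
      zero_mem' := by simp
      smul_mem' := fun c x hx => ⟨by simp [hx.1], by
        simp only [Pi.smul_apply, smul_eq_mul, mul_assoc, ← Finset.mul_sum, hx.2, mul_zero]⟩ }
  obtain ⟨v', hv', rfl⟩ : d' ∈ S.map (gradLin G) :=
    (S.map (gradLin G)).closed_of_finiteDimensional.mem_of_tendsto hvψ
      (Eventually.of_forall fun k => ⟨_, ⟨h.v_base _, h.v_mem hg _⟩, rfl⟩)
  rw [gradLin_apply] at hvψ hdψ
  have hs : IsSaddle G (zeroExtend B g) (fun i j => a i j / (2 * α)) vg v' b' := by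
    refine ⟨hv'.2, fun φ hφ => ?_, fun i j => ?_⟩
    · have h1 := ((hvψ.sub hdψ).add hbψ)
      rw [sub_self, zero_add] at h1
      have h2 := (continuous_edgeInner.tendsto _).comp
        ((tendsto_const_nhds (x := grad G φ)).prodMk_nhds h1)
      refine tendsto_nhds_unique h2 ?_
      refine tendsto_const_nhds.congr fun k => ?_
      exact (h.edgeInner_grad_eq_zero ha.mem_edgeSpace hb0 hd0 (ψ k) hφ).symm
    · have h1 := tendsto_pi_nhds.1 (tendsto_pi_nhds.1 hbψ i) j
      have h2 := (tendsto_pi_nhds.1 (tendsto_pi_nhds.1 hdψ i) j).add_const (grad G vg i j)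
      refine (isClosed_isAbsSubgrad (a i j / (2 * α))).mem_of_tendsto (h2.prodMk_nhds h1) ?_
      filter_upwards [hψ.tendsto_atTop.eventually_ge_atTop 1] with k hk
      obtain ⟨m, hm⟩ := Nat.exists_eq_add_of_le' hk
      rw [hm]
      exact h.isAbsSubgrad ha.nonneg hα m i j
  have hE : Tendsto (fun k => energy b' (grad G v') (b k) (d k)) atTop (𝓝 0) := by
    have hlimE := tendsto_atTop_ciInf (hanti hs) ⟨0, by
      rintro _ ⟨k, rfl⟩; exact energy_nonneg _ _ _ _⟩
    have h1 : Tendsto (fun k => energy b' (grad G v') (b (ψ k)) (d (ψ k))) atTop (𝓝 0) := by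
      have hb1 := hbψ.sub_const b'
      have hd1 := hdψ.sub_const (grad G v')
      have := ((continuous_edgeInner.tendsto _).comp (hb1.prodMk_nhds hb1)).add
        ((continuous_edgeInner.tendsto _).comp (hd1.prodMk_nhds hd1))
      simpa [edgeInner, energy] using this
    rwa [← tendsto_nhds_unique (hlimE.comp hψ.tendsto_atTop) h1]
  have hb : Tendsto b atTop (𝓝 b') := by
    have := tendsto_of_edgeInner (squeeze_zero (fun k => edgeInner_self_nonneg (b k - b'))
      (fun k => le_add_of_nonneg_right (edgeInner_self_nonneg (d k - grad G v'))) hE)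
    simpa using this.add_const b'
  have hd : Tendsto d atTop (𝓝 (grad G v')) := by
    have := tendsto_of_edgeInner (squeeze_zero
      (fun k => edgeInner_self_nonneg (d k - grad G v'))
      (fun k => le_add_of_nonneg_left (edgeInner_self_nonneg (b k - b'))) hE)
    simpa using this.add_const (grad G v')
  refine ⟨v', b', hs, (tendsto_add_atTop_iff_nat 1).1 ?_, hb, hd⟩
  refine tendsto_of_tendsto_grad (o := o) hG ?_ (by simpa using hres.add hd)
  simp only [h.v_base, hv'.1]
  exact tendsto_const_nhds

end Convergence

lemma mem_dualFeasible_iff {G : SimpleGraph V} {B : Finset V} {g : B → ℝ} {a : V → V → ℝ}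
    {b : V → V → ℝ} :
    b ∈ dualFeasible G B g a ↔ b ∈ edgeSpace G ∧ (∃ μ : ℝ, div b = μ • zeroExtend B g) ∧
      ∀ i j, |b i j| ≤ 1 / 2 * a i j := by
  have : ∀ μ : ℝ, div b = μ • zeroExtend B g ↔
      (∀ i, i ∉ B → div b i = 0) ∧ ∀ i : B, div b i = μ * g i := fun μ => by
    rw [← zeroExtend_smul, eq_zeroExtend_iff]; rfl
  simp only [this]
  rfl

section Duality

variable {G : SimpleGraph V} [DecidableRel G.Adj] {B : Finset V} {g : B → ℝ} {a : V → V → ℝ}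
  {vg : V → ℝ}

lemma IsAbsSubgrad.smul {t x y r : ℝ} (h : IsAbsSubgrad t x y) (hr : 0 ≤ r) :
    IsAbsSubgrad (r * t) x (r * y) := by
  refine ⟨?_, by rw [mul_assoc, h.2, mul_assoc]⟩
  rw [abs_mul, abs_of_nonneg hr]
  exact mul_le_mul_of_nonneg_left h.1 hr

lemma IsSaddle.smul {γ : V → ℝ} {t : V → V → ℝ} {v : V → ℝ} {b : V → V → ℝ}
    (h : IsSaddle G γ t vg v b) {r : ℝ} (hr : 0 ≤ r) :
    IsSaddle G γ (r • t) vg v (r • b) := by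
  refine ⟨h.primal, fun φ hφ => ?_, fun i j => (h.subgrad i j).smul hr⟩
  have := h.orthogonal φ hφ
  simp only [edgeInner, Pi.smul_apply, smul_eq_mul, mul_left_comm _ r, ← Finset.mul_sum] at this ⊢
  rw [this, mul_zero]

lemma IsSaddle.mem_edgeSpace {γ : V → ℝ} {v : V → ℝ} {J : V → V → ℝ}
    (h : IsSaddle G γ a vg v J) (ha : a ∈ edgeSpace G) : J ∈ edgeSpace G := fun i j hij => by
  have := (h.subgrad i j).1
  rw [ha i j hij] at this
  exact abs_nonpos_iff.1 this

/-- The dual objective is the multiplier of a feasible matrix. -/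
lemma dualObj_eq (hvg : ∑ i : B, vg i * g i = 1) {b : V → V → ℝ} (hb : b ∈ edgeSpace G) {μ : ℝ}
    (hμ : div b = μ • zeroExtend B g) : dualObj G vg b = μ := by
  rw [dualObj, edgeInner_comm, edgeInner_grad vg hb, hμ, neg_neg]
  simp only [Pi.smul_apply, smul_eq_mul, mul_left_comm _ μ, ← Finset.mul_sum,
    sum_mul_zeroExtend, hvg, mul_one]

/-- Weak duality. -/
lemma dualObj_le_primalObj {u : V → ℝ} (hu : u ∈ primalSpace B g) {b : V → V → ℝ}
    (hb : b ∈ dualFeasible G B g a) : dualObj G vg b ≤ primalObj G a vg u := by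
  obtain ⟨hbE, ⟨μ, hμ⟩, hba⟩ := mem_dualFeasible_iff.1 hb
  have hu' : ∑ i : B, u i * g i = 0 := hu
  have h0 : edgeInner b (grad G u) = 0 := by
    rw [edgeInner_comm, edgeInner_grad u hbE, hμ]
    simp only [Pi.smul_apply, smul_eq_mul, mul_left_comm _ μ, ← Finset.mul_sum,
      sum_mul_zeroExtend, hu', mul_zero, neg_zero]
  have h1 : dualObj G vg b = ∑ i, ∑ j, -(b i j * (grad G u i j + grad G vg i j)) := by
    simp only [Finset.sum_neg_distrib, mul_add, Finset.sum_add_distrib]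
    change _ = -(edgeInner b (grad G u) + edgeInner b (grad G vg))
    rw [h0, zero_add, dualObj]
  rw [h1, primalObj, edgeInner, Finset.mul_sum]
  refine Finset.sum_le_sum fun i _ => ?_
  rw [Finset.mul_sum]
  refine Finset.sum_le_sum fun j _ => ?_
  rw [← mul_assoc]
  refine (neg_le_abs _).trans ?_
  rw [abs_mul]
  exact mul_le_mul_of_nonneg_right (hba i j) (abs_nonneg _)

/-- The dual matrix of a saddle point is feasible, with multiplier the primal value. -/
lemma IsSaddle.div_eq (hvg : ∑ i : B, vg i * g i = 1) (ha : a ∈ edgeSpace G) {v : V → ℝ}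
    {J : V → V → ℝ} (h : IsSaddle G (zeroExtend B g) a vg v J) :
    div (-(1 / 2 : ℝ) • J) = primalObj G a vg v • zeroExtend B g := by
  have hJ := h.mem_edgeSpace ha
  have hval : ∑ i, vg i * div J i = -2 * primalObj G a vg v := by
    have h0 := h.orthogonal v h.primal
    have h1 : edgeInner (grad G v) J + edgeInner (grad G vg) J
        = edgeInner a (fun i j => |grad G v i j + grad G vg i j|) := by
      simp only [edgeInner, ← Finset.sum_add_distrib]
      refine Finset.sum_congr rfl fun i _ => Finset.sum_congr rfl fun j _ => ?_
      rw [← (h.subgrad i j).2]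
      ring
    rw [h0, zero_add, edgeInner_grad vg hJ] at h1
    rw [primalObj, ← h1]
    ring
  classical
  funext i
  set φ : V → ℝ := Pi.single i 1 - zeroExtend B g i • vg with hφ
  have hsingle : ∀ f : V → ℝ, ∑ j, φ j * f j = f i - zeroExtend B g i * ∑ j, vg j * f j := by
    intro f
    simp only [hφ, Pi.sub_apply, Pi.smul_apply, smul_eq_mul, sub_mul, Finset.sum_sub_distrib,
      mul_assoc, Finset.mul_sum]
    congr 1
    simp [Pi.single_apply]
  have hφ0 : ∑ j, φ j * zeroExtend B g j = 0 := by
    rw [hsingle, sum_mul_zeroExtend, hvg]; ring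
  have := h.orthogonal φ hφ0
  rw [edgeInner_grad φ hJ, hsingle, hval] at this
  rw [div_smul]
  simp only [Pi.smul_apply, smul_eq_mul]
  linarith

lemma IsSaddle.mem_dualFeasible (hvg : ∑ i : B, vg i * g i = 1) (ha : a ∈ edgeSpace G)
    {v : V → ℝ} {J : V → V → ℝ} (h : IsSaddle G (zeroExtend B g) a vg v J) :
    -(1 / 2 : ℝ) • J ∈ dualFeasible G B g a := by
  refine mem_dualFeasible_iff.2 ⟨fun i j hij => ?_, ⟨_, h.div_eq hvg ha⟩, fun i j => ?_⟩
  · simp [h.mem_edgeSpace ha i j hij]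
  · simp only [Pi.smul_apply, smul_eq_mul, abs_mul, abs_neg]
    rw [abs_of_pos (by norm_num : (0 : ℝ) < 1 / 2)]
    exact mul_le_mul_of_nonneg_left (h.subgrad i j).1 (by norm_num)

/-- Strong duality at a saddle point. -/
lemma IsSaddle.dualObj_eq_primalObj (hvg : ∑ i : B, vg i * g i = 1) (ha : a ∈ edgeSpace G)
    {v : V → ℝ} {J : V → V → ℝ} (h : IsSaddle G (zeroExtend B g) a vg v J) :
    dualObj G vg (-(1 / 2 : ℝ) • J) = primalObj G a vg v :=
  dualObj_eq hvg (h.mem_dualFeasible hvg ha).1 (h.div_eq hvg ha)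

lemma IsSaddle.isPrimalSolution (hvg : ∑ i : B, vg i * g i = 1) (ha : a ∈ edgeSpace G)
    {v : V → ℝ} {J : V → V → ℝ} (h : IsSaddle G (zeroExtend B g) a vg v J) :
    IsPrimalSolution G B g a vg v := by
  refine ⟨(sum_mul_zeroExtend B g v).symm.trans h.primal, fun u hu => ?_⟩
  change primalObj G a vg v ≤ primalObj G a vg u
  rw [← h.dualObj_eq_primalObj hvg ha]
  exact dualObj_le_primalObj hu (h.mem_dualFeasible hvg ha)

lemma IsSaddle.isDualSolution (hvg : ∑ i : B, vg i * g i = 1) (ha : a ∈ edgeSpace G)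
    {v : V → ℝ} {J : V → V → ℝ} (h : IsSaddle G (zeroExtend B g) a vg v J) :
    IsDualSolution G B g a vg (-(1 / 2 : ℝ) • J) := by
  refine ⟨h.mem_dualFeasible hvg ha, fun b hb => ?_⟩
  change dualObj G vg b ≤ dualObj G vg (-(1 / 2 : ℝ) • J)
  rw [h.dualObj_eq_primalObj hvg ha]
  exact dualObj_le_primalObj ((sum_mul_zeroExtend B g v).symm.trans h.primal) hb

/-- At a saddle point the current obeys `J (w_i - w_j) = a |w_i - w_j|` for `w = v + v_g`. -/
lemma IsSaddle.mul_sub_eq (ha : a ∈ edgeSpace G) {γ v : V → ℝ} {J : V → V → ℝ}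
    (h : IsSaddle G γ a vg v J) (i j : V) :
    J i j * ((v + vg) i - (v + vg) j) = a i j * |(v + vg) i - (v + vg) j| := by
  by_cases hij : G.Adj i j
  · have h1 := (h.subgrad i j).2
    simp only [grad, hij, if_true] at h1
    have h2 : (v + vg) i - (v + vg) j = v i - v j + (vg i - vg j) := by
      simp only [Pi.add_apply]; ring
    rw [h2, h1]
  · rw [h.mem_edgeSpace ha i j hij, ha i j hij, zero_mul, zero_mul]

lemma IsSaddle.abs_eq (ha : IsMeasurement G a) {γ v : V → ℝ} {J : V → V → ℝ}
    (h : IsSaddle G γ a vg v J) {i j : V} (hij : (v + vg) i ≠ (v + vg) j) :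
    |J i j| = a i j := by
  have h1 := congrArg abs (h.mul_sub_eq ha.mem_edgeSpace i j)
  rw [abs_mul, abs_mul, abs_abs, abs_of_nonneg (ha.nonneg i j)] at h1
  exact mul_right_cancel₀ (abs_ne_zero.2 (sub_ne_zero.2 hij)) h1

/-- Replacing the dual matrix of a saddle point by its antisymmetric part. -/
lemma IsSaddle.antisymmPart (ha : IsMeasurement G a) {γ v : V → ℝ} {J : V → V → ℝ}
    (h : IsSaddle G γ a vg v J) : IsSaddle G γ a vg v (fun i j => (J i j - J j i) / 2) := by
  refine ⟨h.primal, fun φ hφ => ?_, fun i j => ⟨?_, ?_⟩⟩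
  · have h1 := h.orthogonal φ hφ
    have h2 : ∑ i, ∑ j, grad G φ i j * J j i = - edgeInner (grad G φ) J := by
      rw [Finset.sum_comm, edgeInner, ← Finset.sum_neg_distrib]
      refine Finset.sum_congr rfl fun i _ => ?_
      rw [← Finset.sum_neg_distrib]
      exact Finset.sum_congr rfl fun j _ => by rw [grad_antisymm G φ j i]; ring
    have h3 : edgeInner (grad G φ) (fun i j => (J i j - J j i) / 2)
        = (edgeInner (grad G φ) J - ∑ i, ∑ j, grad G φ i j * J j i) / 2 := by
      simp only [edgeInner, ← Finset.sum_sub_distrib, Finset.sum_div]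
      exact Finset.sum_congr rfl fun i _ => Finset.sum_congr rfl fun j _ => by ring
    rw [h3, h2, h1]
    simp
  · have h1 := abs_le.1 (h.subgrad i j).1
    have h2 := abs_le.1 (h.subgrad j i).1
    rw [ha.symm j i] at h2
    exact abs_le.2 ⟨by linarith [h1.1, h2.2], by linarith [h1.2, h2.1]⟩
  · have h1 := (h.subgrad i j).2
    have h2 := (h.subgrad j i).2
    rw [grad_antisymm G v j i, grad_antisymm G vg j i, ← neg_add, abs_neg, ha.symm j i] at h2
    linarith

/-- The antisymmetric dual matrix of a saddle point is an induced current. -/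
lemma IsSaddle.exists_isInducedBy (hvg : ∑ i : B, vg i * g i = 1) (ha : IsMeasurement G a)
    {v : V → ℝ} {J : V → V → ℝ} (h : IsSaddle G (zeroExtend B g) a vg v J)
    (hJ : ∀ i j, J i j = - J j i) :
    ∃ σ, IsInducedBy G B (primalObj G a vg v • g) a σ (v + vg) J := by
  classical
  have hrow : (fun i => ∑ j, J i j) = zeroExtend B (primalObj G a vg v • g) := by
    rw [zeroExtend_smul, ← h.div_eq hvg ha.mem_edgeSpace, div_smul]
    funext i
    rw [Pi.smul_apply, div_of_antisymm hJ, smul_eq_mul]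
    ring
  obtain ⟨hinterior, hbd⟩ := (eq_zeroExtend_iff _ _ _).1 hrow
  set w : V → ℝ := v + vg with hw
  refine ⟨fun i j => if G.Adj i j then
      if w i = w j then ∞ else ENNReal.ofReal (a i j / |w i - w j|) else 0,
    { conductivity_symm := fun i j => by
        simp only [G.adj_comm i j, eq_comm (a := w i), ha.symm i j, abs_sub_comm (w i)]
      conductivity_off_edges := fun i j hij => if_neg hij
      current_mem := h.mem_edgeSpace ha.mem_edgeSpace
      current_antisymm := hJ
      ohm := fun i j hij => ?_
      magnitude := fun i j hij => h.abs_eq ha hij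
      perfect_conductor := fun i j haij hij => ?_
      kirchhoff_boundary := hbd
      kirchhoff_interior := hinterior }⟩
  · by_cases hadj : G.Adj i j
    · simp only [if_pos hadj, if_neg hij]
      refine ⟨ENNReal.ofReal_ne_top, ?_⟩
      rw [ENNReal.toReal_ofReal (div_nonneg (ha.nonneg i j) (abs_nonneg _))]
      have h1 : w i - w j ≠ 0 := sub_ne_zero.2 hij
      have h2 := h.mul_sub_eq ha.mem_edgeSpace i j
      rw [← hw] at h2
      refine mul_right_cancel₀ h1 (h2.trans ?_)
      rw [mul_assoc, ← abs_mul_abs_self (w i - w j)]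
      field_simp
    · simp [hadj, h.mem_edgeSpace ha.mem_edgeSpace i j hadj]
  · have hadj : G.Adj i j := by
      by_contra hadj
      exact haij (ha.mem_edgeSpace i j hadj)
    simp only [if_pos hadj, if_pos hij]

end Duality

end Network

end

theorem mainTheorem10 {V : Type*} [Fintype V] (G : SimpleGraph V) [DecidableRel G.Adj]
    (hG : G.Connected) (B : Finset V) (g : B → ℝ) (hg : g ≠ 0) (hgsum : ∑ i : B, g i = 0)
    (a : V → V → ℝ) (ha : Network.IsMeasurement G a) (α : ℝ) (hα : 0 < α) (o : V)
    (vg : V → ℝ) (hvg : ∑ i : B, vg i * g i = 1)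
    (b0 d0 : V → V → ℝ) (hb0 : b0 ∈ Network.edgeSpace G) (hd0 : d0 ∈ Network.edgeSpace G) :
    (∃ z u β v d b, Network.IsRun G B g a α o vg b0 d0 z u β v d b) ∧
    ∀ z u β v d b, Network.IsRun G B g a α o vg b0 d0 z u β v d b →
      ∃ (v' : V → ℝ) (J : V → V → ℝ) (lam : ℝ),
        -- convergence of the iterates
        Tendsto v atTop (𝓝 v') ∧
        Tendsto b atTop (𝓝 ((1 / (2 * α)) • J)) ∧
        Tendsto d atTop (𝓝 (Network.grad G v')) ∧
        -- the limits solve the primal and the dual problem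
        Network.IsPrimalSolution G B g a vg v' ∧
        Network.IsDualSolution G B g a vg (-(1 / 2 : ℝ) • J) ∧
        -- `lam` is the optimal value of both problems
        IsLeast (Network.primalObj G a vg '' Network.primalSpace B g) lam ∧
        IsGreatest (Network.dualObj G vg '' Network.dualFeasible G B g a) lam ∧
        -- the limit potential is a voltage potential for `(lam g, a)`
        v' + vg ∈ Network.voltagePotentials G B (lam • g) a ∧
        -- the magnitude of `J` is `a` wherever the potential differs
        (∀ i j, (v' + vg) i ≠ (v' + vg) j → |J i j| = a i j) ∧
        -- the antisymmetric part of `J` is the induced current; it is `J` if `b0` is antisymmetric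
        (∃ σ, Network.IsInducedBy G B (lam • g) a σ (v' + vg)
          (fun i j => (J i j - J j i) / 2)) ∧
        ((∀ i j, b0 i j = - b0 j i) →
          ∃ σ, Network.IsInducedBy G B (lam • g) a σ (v' + vg) J) := by
  refine ⟨Network.exists_isRun hG B g hgsum a α o vg b0 d0, fun z u β v d b h => ?_⟩
  obtain ⟨v', b', hs', hv, hb, hd⟩ :=
    h.exists_tendsto_isSaddle hG hg hgsum ha hα hvg hb0 hd0
  have hα' : 2 * α ≠ 0 := by positivity
  have hs : Network.IsSaddle G (Network.zeroExtend B g) a vg v' ((2 * α) • b') := by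
    convert hs'.smul (r := 2 * α) (by positivity) using 1
    funext i j
    simp only [Pi.smul_apply, smul_eq_mul]
    field_simp
  have haE := ha.mem_edgeSpace
  have hP := hs.isPrimalSolution hvg haE
  have hD := hs.isDualSolution hvg haE
  have hA := (hs.antisymmPart ha).exists_isInducedBy hvg ha fun i j => by ring
  refine ⟨v', (2 * α) • b', Network.primalObj G a vg v', hv, ?_, hd, hP, hD,
    ⟨⟨v', hP.1, rfl⟩, ?_⟩, ⟨⟨_, hD.1, hs.dualObj_eq_primalObj hvg haE⟩, ?_⟩, ?_,
    fun i j hij => hs.abs_eq ha hij, hA, fun hanti => hs.exists_isInducedBy hvg ha fun i j => ?_⟩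
  · rwa [smul_smul, one_div_mul_cancel hα', one_smul]
  · rintro _ ⟨w, hw, rfl⟩
    exact hP.2 hw
  · rintro _ ⟨c, hc, rfl⟩
    exact Network.dualObj_le_primalObj hP.1 hc
  · obtain ⟨σ, hσ⟩ := hA
    exact ⟨σ, _, hσ⟩
  · have hlim : ∀ i j, Tendsto (fun k => b k i j) atTop (𝓝 (b' i j)) := fun i j =>
      tendsto_pi_nhds.1 (tendsto_pi_nhds.1 hb i) j
    have hb' : b' i j = - b' j i := tendsto_nhds_unique (hlim i j)
      ((hlim j i).neg.congr fun k => (h.antisymm ha.symm hanti k i j).symm)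
    simp only [Pi.smul_apply, smul_eq_mul, hb']
    ring
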